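/- Let $n$ be a positive integer and $d$ a nonnegative integer. Let $\mathbb{C}[Z,\bar Z]$ be the complex polynomial algebra on the $2(n+1)$ indeterminates $Z_0,\dots,Z_n,\bar Z_0,\dots,\bar Z_n$. For a multiindex $\alpha=(\alpha_0,\dots,\alpha_n)$ of nonnegative integers write $|\alpha|=\alpha_0+\cdots+\alpha_n$, $Z^\alpha=Z_0^{\alpha_0}\cdots Z_n^{\alpha_n}$ and $\bar Z^\alpha=\bar Z_0^{\alpha_0}\cdots \bar Z_n^{\alpha_n}$. Let $$p=\sum_{|\alpha|=|\beta|=d}a_{\alpha\beta}Z^\alpha\bar Z^\beta\in\mathbb{C}[Z,\bar Z]$$ be a bihomogeneous polynomial of bidegree $(d,d)$ that is Hermitian, i.e. $\overline{a_{\alpha\beta}}=a_{\beta\alpha}$ for all $\alpha,\beta$. For a polynomial $s=\sum_\alpha c_\alpha Z^\alpha\in\mathbb{C}[Z_0,\dots,Z_n]$ put $|s(Z)|^2=s(Z)\,\overline{s(Z)}\in\mathbb{C}[Z,\bar Z]$, where $\overline{s(Z)}=\sum_\alpha\overline{c_\alpha}\,\bar Z^\alpha$. **Quillen's Positivstellensatz.**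 Suppose that $p(z,\bar z)>0$ for every $z\in\mathbb{C}^{n+1}$ with $z\ne 0$. Then there is an integer $M$ such that for every integer $m\ge M$, $m\ge 0$, there is a basis $\{s_\eta\}_{|\eta|=m+d}$, indexed by the multiindices $\eta$ of length $m+d$, of the complex vector space of homogeneous polynomials of degree $m+d$ in $\mathbb{C}[Z_0,\dots,Z_n]$ such that $$(|Z_0|^2+\cdots+|Z_n|^2)^m\,p(Z,\bar Z)=\sum_{|\eta|=m+d}|s_\eta(Z)|^2$$ as polynomials in $\mathbb{C}[Z,\bar Z]$. -/

import Mathlib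

open scoped ComplexOrder

noncomputable section

namespace HermitianPoly

/-- Multiindices `α = (α_0, …, α_n)` of nonnegative integers of length `|α| = k`. -/
abbrev MultiIndex (n k : ℕ) : Type := {α : Fin (n + 1) →₀ ℕ // α.degree = k}

instance (n k : ℕ) : Fintype (MultiIndex n k) :=
  Fintype.ofInjective
    (fun α => (⟨α.1, Finset.mem_finsuppAntidiag.2
      ⟨by rw [← Finsupp.degree_eq_sum]; exact α.2, Finset.subset_univ _⟩⟩ :
        {f // f ∈ Finset.finsuppAntidiag (Finset.univ : Finset (Fin (n + 1))) k}))
    (fun _ _ h => Subtype.ext (congrArg (fun x => x.1) h))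

/-- The algebra `ℂ[Z_0, …, Z_n]` of holomorphic polynomials. -/
abbrev HolPoly (n : ℕ) : Type := MvPolynomial (Fin (n + 1)) ℂ

/-- The algebra `ℂ[Z, Z̄]` on the indeterminates `Z_0, …, Z_n, Z̄_0, …, Z̄_n`:
`Sum.inl i` indexes `Z_i`, and `Sum.inr i` indexes `Z̄_i`. -/
abbrev MixedPoly (n : ℕ) : Type := MvPolynomial (Fin (n + 1) ⊕ Fin (n + 1)) ℂ

variable {n : ℕ}

/-- The coefficient `a_{αβ}` of `Z^α Z̄^β`. -/
def mixedCoeff (p : MixedPoly n) (α β : Fin (n + 1) →₀ ℕ) : ℂ :=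
  MvPolynomial.coeff (Finsupp.sumElim α β) p

/-- `p` is bihomogeneous of bidegree `(d, d)`: only monomials `Z^α Z̄^β` with
`|α| = |β| = d` occur in it. -/
def IsBihomogeneous (p : MixedPoly n) (d : ℕ) : Prop :=
  ∀ α β : Fin (n + 1) →₀ ℕ, mixedCoeff p α β ≠ 0 → α.degree = d ∧ β.degree = d

/-- `p` is Hermitian: the conjugate of `a_{αβ}` is `a_{βα}`. -/
def IsHermitian (p : MixedPoly n) : Prop :=
  ∀ α β : Fin (n + 1) →₀ ℕ, starRingEnd ℂ (mixedCoeff p α β) = mixedCoeff p β α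

/-- The value `p(z, z̄)`. -/
def evalAt (p : MixedPoly n) (z : Fin (n + 1) → ℂ) : ℂ :=
  MvPolynomial.eval (Sum.elim z (fun i => starRingEnd ℂ (z i))) p

/-- The holomorphic polynomial `s(Z)` as an element of `ℂ[Z, Z̄]`. -/
def hol (s : HolPoly n) : MixedPoly n := MvPolynomial.rename Sum.inl s

/-- The conjugate of `s(Z)`: coefficients are conjugated and `Z_i` becomes `Z̄_i`. -/
def antihol (s : HolPoly n) : MixedPoly n :=
  MvPolynomial.rename Sum.inr (MvPolynomial.map (starRingEnd ℂ) s)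

/-- `|s(Z)|² = s(Z) · conj (s(Z))`. -/
def absSq (s : HolPoly n) : MixedPoly n := hol s * antihol s

end HermitianPoly

end

/-! Let `A_m` be the matrix of coefficients of `|Z|^{2m} p` in bidegree `(m+d, m+d)`. A
factorization `A_m = B* B` with `B` invertible is exactly a basis whose squares sum to `|Z|^{2m} p`
(`exists_basis_sum_absSq`), so it suffices that `A_m` be positive definite for large `m`.

Up to the factor `α! β! / m!`, the entries of `A_m` are Gaussian integrals of `σ z^β conj(z^α)`,
with the symbol `σ = exp(-∑ ∂_{z_i} ∂_{z̄_i}) p` independent of `m`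
(`factorial_mul_mixedCoeff_eq_integral`). Hence the quadratic form of `A_m` is `m! ∫ σ |f|²`, with
`f` homogeneous of degree `N = m + d`: a Toeplitz form on Bargmann–Fock space.

The top-degree part of `σ` is `p`, so for `d ≥ 1` positivity on the sphere and scaling give `σ ≥
c|z|² - K` with `c > 0` (`exists_le_hermiteSymbol`). Homogeneous polynomials of high degree live far
from the origin: `∫ |z|² |f|² = (N + n + 1) ∫ |f|²` (`integral_sum_norm_mul_polyFun`). The form is
therefore positive once `c (N + n + 1) > K`. -/

noncomputable section

namespace HermitianPoly

open MeasureTheory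

/-! ### The Gaussian measure on `ℂ` -/

/-- The Gaussian density `exp (-|w|²) / π`. -/
def gaussianDensity (w : ℂ) : ℝ := Real.exp (-‖w‖ ^ 2) / Real.pi

/-- The Gaussian probability measure `π⁻¹ exp (-|w|²) dw` on `ℂ`. -/
def gaussianMeasure : Measure ℂ :=
  volume.withDensity fun w => ENNReal.ofReal (gaussianDensity w)

theorem gaussianDensity_nonneg (w : ℂ) : 0 ≤ gaussianDensity w := by
  unfold gaussianDensity; positivity

theorem continuous_gaussianDensity : Continuous gaussianDensity := by
  unfold gaussianDensity; fun_prop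

theorem integral_pow_mul_gaussianDensity (k : ℕ) :
    ∫ w : ℂ, ‖w‖ ^ (2 * k) * gaussianDensity w = k.factorial := by
  have h := Complex.integral_rpow_mul_exp_neg_rpow (p := 2) (q := (2 * k : ℕ)) (by norm_num)
    (lt_of_lt_of_le (by norm_num) (Nat.cast_nonneg _))
  have h2 : (((2 * k : ℕ) : ℝ) + 2) / 2 = k + 1 := by push_cast; ring
  rw [h2, Real.Gamma_nat_eq_factorial] at h
  simp only [Real.rpow_natCast, Real.rpow_two] at h
  simp only [gaussianDensity, ← mul_div_assoc]
  rw [integral_div, h]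
  field_simp

theorem integrable_pow_mul_gaussianDensity (k : ℕ) :
    Integrable fun w : ℂ => ‖w‖ ^ (2 * k) * gaussianDensity w := by
  -- A nonintegrable function has Bochner integral zero, so the nonzero value `k!` already proves
  -- integrability.
  refine Integrable.of_integral_ne_zero ?_
  rw [integral_pow_mul_gaussianDensity]
  positivity

instance : IsFiniteMeasure gaussianMeasure :=
  isFiniteMeasure_withDensity_ofReal
    (by simpa using (integrable_pow_mul_gaussianDensity 0).hasFiniteIntegral)

theorem integrable_gaussianMeasure_iff {f : ℂ → ℂ} :
    Integrable f gaussianMeasure ↔ Integrable fun w => gaussianDensity w • f w := by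
  unfold gaussianMeasure
  rw [integrable_withDensity_iff_integrable_smul'
    continuous_gaussianDensity.measurable.ennreal_ofReal (by simp)]
  simp only [ENNReal.toReal_ofReal (gaussianDensity_nonneg _)]

theorem integral_gaussianMeasure (f : ℂ → ℂ) :
    ∫ w, f w ∂gaussianMeasure = ∫ w, gaussianDensity w • f w := by
  unfold gaussianMeasure
  rw [integral_withDensity_eq_integral_toReal_smul
    continuous_gaussianDensity.measurable.ennreal_ofReal (by simp)]
  simp only [ENNReal.toReal_ofReal (gaussianDensity_nonneg _)]

theorem integrable_gaussian_monomial (b a : ℕ) :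
    Integrable (fun w : ℂ => w ^ b * starRingEnd ℂ w ^ a) gaussianMeasure := by
  rw [integrable_gaussianMeasure_iff]
  refine ((integrable_pow_mul_gaussianDensity b).add (integrable_pow_mul_gaussianDensity a)).mono'
    (Continuous.aestronglyMeasurable ?_) (Filter.Eventually.of_forall fun w => ?_)
  · have := continuous_gaussianDensity
    fun_prop
  · simp only [norm_smul, norm_mul, norm_pow, RCLike.norm_conj, Pi.add_apply, Real.norm_eq_abs,
      abs_of_nonneg (gaussianDensity_nonneg w)]
    have h1 : ‖w‖ ^ b * ‖w‖ ^ a ≤ ‖w‖ ^ (2 * b) + ‖w‖ ^ (2 * a) := by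
      rw [pow_mul', pow_mul']
      nlinarith [sq_nonneg (‖w‖ ^ b - ‖w‖ ^ a), sq_nonneg (‖w‖ ^ b), sq_nonneg (‖w‖ ^ a)]
    nlinarith [gaussianDensity_nonneg w]

theorem integral_gaussian_monomial (b a : ℕ) :
    ∫ w : ℂ, w ^ b * starRingEnd ℂ w ^ a ∂gaussianMeasure
      = if b = a then (b.factorial : ℂ) else 0 := by
  rw [integral_gaussianMeasure]
  split_ifs with h
  · subst h
    rw [← Complex.ofReal_natCast, ← integral_pow_mul_gaussianDensity, ← integral_complex_ofReal]
    refine integral_congr_ae (Filter.Eventually.of_forall fun w => ?_)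
    simp only [← mul_pow, Complex.mul_conj, Complex.normSq_eq_norm_sq, Complex.real_smul]
    push_cast
    ring
  · set F : ℂ → ℂ := fun w => gaussianDensity w • (w ^ b * starRingEnd ℂ w ^ a) with hF
    -- For this angle `u^b ū^a = exp(iπ) = -1`: rotation by `u` preserves the measure but negates
    -- the integrand.
    set u : Circle := Circle.exp (Real.pi / (b - a)) with hu
    have hba : (b : ℂ) - a ≠ 0 := sub_ne_zero.2 (by exact_mod_cast h)
    have hu1 : (u : ℂ) ^ b * starRingEnd ℂ (u : ℂ) ^ a = -1 := by
      rw [hu, Circle.coe_exp, ← Complex.exp_conj, ← Complex.exp_nat_mul, ← Complex.exp_nat_mul,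
        ← Complex.exp_add, ← Complex.exp_pi_mul_I]
      congr 1
      simp
      field_simp
      ring
    have hrot := (LinearIsometryEquiv.measurePreserving (rotation u)).integral_comp
      (rotation u).toHomeomorph.measurableEmbedding F
    have hneg : ∀ w, F (rotation u w) = - F w := by
      intro w
      have hn : gaussianDensity (u * w) = gaussianDensity w := by
        simp only [gaussianDensity, norm_mul, Circle.norm_coe, one_mul]
      simp only [hF, rotation_apply, map_mul, hn]
      rw [mul_pow, mul_pow, ← smul_neg]
      congr 1
      linear_combination (w ^ b * starRingEnd ℂ w ^ a) * hu1
    simp only [hneg, integral_neg] at hrot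
    exact self_eq_neg.1 hrot.symm

/-! ### Complex Hermite polynomials -/

/-- The complex Hermite polynomial `exp (-h ∂_w ∂_w̄) (w^c w̄^e)`. -/
def complexHermite (h : ℝ) : ℕ → ℕ → ℂ → ℂ
  | 0, e, w => starRingEnd ℂ w ^ e
  | c + 1, e, w => w * complexHermite h c e w - h * e * complexHermite h c (e - 1) w

theorem complexHermite_zero (c e : ℕ) (w : ℂ) :
    complexHermite 0 c e w = w ^ c * starRingEnd ℂ w ^ e := by
  induction c with
  | zero => simp [complexHermite]
  | succ c ih => simp [complexHermite, ih, pow_succ']; ring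

theorem continuous_complexHermite (c e : ℕ) :
    Continuous fun x : ℝ × ℂ => complexHermite x.1 c e x.2 := by
  induction c generalizing e with
  | zero => simp only [complexHermite]; fun_prop
  | succ c ih =>
    have h1 := ih e
    have h2 := ih (e - 1)
    simp only [complexHermite]
    fun_prop

/-- Each factor `h` comes with `∂_w ∂_w̄`, which lowers the degree by two, so `h` has weight two
under dilation. -/
theorem complexHermite_smul (h r : ℝ) (c e : ℕ) (w : ℂ) :
    complexHermite (r ^ 2 * h) c e (r * w) = r ^ (c + e) * complexHermite h c e w := by
  induction c generalizing e with
  | zero => simp [complexHermite, mul_pow]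
  | succ c ih =>
    cases e with
    | zero => simp only [complexHermite, ih]; simp; ring
    | succ e => simp only [complexHermite, ih, Nat.add_sub_cancel]; push_cast; ring

theorem integrable_complexHermite (h : ℝ) (c e b a : ℕ) :
    Integrable (fun w => complexHermite h c e w * (w ^ b * starRingEnd ℂ w ^ a))
      gaussianMeasure := by
  induction c generalizing e b with
  | zero =>
    convert integrable_gaussian_monomial b (e + a) using 2 with w
    simp only [complexHermite]; ring
  | succ c ih =>
    convert (ih e (b + 1)).sub ((ih (e - 1) b).const_mul (h * e : ℂ)) using 2 with w
    simp only [complexHermite, Pi.sub_apply]; ring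

/-- The twist by `exp(-∂_w ∂_w̄)` turns antinormal into normal ordering: the integral is the Fock
pairing of `∂^e w^b` with `∂^c w^a`. This is what matches the coefficients of `|Z|^{2m} p`. -/
theorem integral_complexHermite (c e b a : ℕ) :
    ∫ w, complexHermite 1 c e w * (w ^ b * starRingEnd ℂ w ^ a) ∂gaussianMeasure
      = if c + b = e + a then (b.factorial * a.descFactorial c : ℂ) else 0 := by
  induction c generalizing e b with
  | zero =>
    have : ∀ w : ℂ, complexHermite 1 0 e w * (w ^ b * starRingEnd ℂ w ^ a)
        = w ^ b * starRingEnd ℂ w ^ (e + a) := fun w => by simp only [complexHermite]; ring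
    simp only [this, integral_gaussian_monomial]
    simp
  | succ c ih =>
    have : ∀ w : ℂ, complexHermite 1 (c + 1) e w * (w ^ b * starRingEnd ℂ w ^ a)
        = complexHermite 1 c e w * (w ^ (b + 1) * starRingEnd ℂ w ^ a)
          - e * (complexHermite 1 c (e - 1) w * (w ^ b * starRingEnd ℂ w ^ a)) :=
      fun w => by simp only [complexHermite]; push_cast; ring
    simp only [this]
    rw [integral_sub (integrable_complexHermite _ _ _ _ _)
      ((integrable_complexHermite _ _ _ _ _).const_mul _), integral_const_mul, ih, ih]
    have hc : c + (b + 1) = e + a ↔ c + 1 + b = e + a := by omega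
    simp only [hc]
    -- At `e = 0` the truncated index `e - 1` is harmless, since its term carries the factor `e`.
    rcases Nat.eq_zero_or_pos e with rfl | he
    · rw [Nat.cast_zero, zero_mul, sub_zero]
      split_ifs with h1
      · have : a = b + 1 + c := by omega
        subst this
        rw [Nat.descFactorial_succ, Nat.factorial_succ, Nat.add_sub_cancel]
        push_cast
        ring
      · rfl
    · have hc2 : c + b = e - 1 + a ↔ c + 1 + b = e + a := by omega
      simp only [hc2]
      split_ifs with h1
      · rw [Nat.descFactorial_succ, Nat.factorial_succ]
        rcases lt_or_ge a c with hac | hac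
        · simp [Nat.descFactorial_of_lt hac]
        · have : (b : ℂ) + 1 - e = a - c := by
            have : ((c + 1 + b : ℕ) : ℂ) = (e + a : ℕ) := by rw [h1]
            push_cast at this
            linear_combination this
          push_cast [Nat.cast_sub hac]
          linear_combination ((b.factorial : ℂ) * a.descFactorial c) * this
      · simp

variable {n : ℕ}

/-! ### Coefficients of `|Z|^{2m} p` -/

/-- The polynomial `|Z_0|² + ⋯ + |Z_n|²`. -/
def normSqPoly (n : ℕ) : MixedPoly n :=
  ∑ i : Fin (n + 1), absSq (MvPolynomial.X i : HolPoly n)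

theorem exists_eq_sumElim (σ : Fin (n + 1) ⊕ Fin (n + 1) →₀ ℕ) :
    ∃ γ δ : Fin (n + 1) →₀ ℕ, σ = Finsupp.sumElim γ δ := by
  refine ⟨Finsupp.equivFunOnFinite.symm fun i => σ (Sum.inl i),
    Finsupp.equivFunOnFinite.symm fun i => σ (Sum.inr i), ?_⟩
  ext (i | i) <;> simp

theorem sumElim_injective {α β γ δ : Fin (n + 1) →₀ ℕ}
    (h : Finsupp.sumElim α β = Finsupp.sumElim γ δ) : α = γ ∧ β = δ := by
  constructor <;> ext i
  · simpa using DFunLike.congr_fun h (Sum.inl i)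
  · simpa using DFunLike.congr_fun h (Sum.inr i)

theorem absSq_X (i : Fin (n + 1)) :
    absSq (MvPolynomial.X i : HolPoly n)
      = MvPolynomial.monomial (Finsupp.sumElim (Finsupp.single i 1) (Finsupp.single i 1)) 1 := by
  have : Finsupp.sumElim (Finsupp.single i 1) (Finsupp.single i 1)
      = (Finsupp.single (Sum.inl i) 1 + Finsupp.single (Sum.inr i) 1 :
        Fin (n + 1) ⊕ Fin (n + 1) →₀ ℕ) := by
    ext (j | j) <;> simp [Finsupp.single_apply]
  rw [this]
  simp only [absSq, hol, antihol, MvPolynomial.map_X, MvPolynomial.rename_X]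
  rw [MvPolynomial.X, MvPolynomial.X, MvPolynomial.monomial_mul, one_mul]

theorem prod_absSq_X_pow (k : Fin (n + 1) → ℕ) :
    ∏ i, absSq (MvPolynomial.X i : HolPoly n) ^ k i
      = MvPolynomial.monomial (Finsupp.sumElim (Finsupp.equivFunOnFinite.symm k)
          (Finsupp.equivFunOnFinite.symm k)) 1 := by
  simp only [absSq_X, MvPolynomial.monomial_pow, one_pow]
  rw [← MvPolynomial.monomial_sum_one]
  have : ∑ i, k i • Finsupp.sumElim (Finsupp.single i 1) (Finsupp.single i 1)
      = Finsupp.sumElim (Finsupp.equivFunOnFinite.symm k) (Finsupp.equivFunOnFinite.symm k) := by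
    ext (j | j) <;> simp [Finsupp.finsetSum_apply, Finsupp.single_apply]
  rw [this]

/-- The multinomial theorem, with the denominators `α!` cleared. -/
theorem mixedCoeff_normSqPoly_pow (m : ℕ) (α β : Fin (n + 1) →₀ ℕ) :
    (∏ i, ((α i).factorial : ℂ)) * mixedCoeff (normSqPoly n ^ m) α β
      = if α = β ∧ α.degree = m then (m.factorial : ℂ) else 0 := by
  unfold normSqPoly mixedCoeff
  simp only [Finset.sum_pow_eq_sum_piAntidiag, prod_absSq_X_pow, MvPolynomial.coeff_sum,
    ← map_natCast (MvPolynomial.C : ℂ →+* MixedPoly n), MvPolynomial.coeff_C_mul,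
    MvPolynomial.coeff_monomial]
  split_ifs with h
  · obtain ⟨rfl, hm⟩ := h
    rw [Finset.sum_eq_single (α : Fin (n + 1) → ℕ)]
    · have := Nat.multinomial_spec Finset.univ (α : Fin (n + 1) → ℕ)
      rw [← Finsupp.degree_eq_sum, hm] at this
      simp only [Finsupp.equivFunOnFinite_symm_coe, if_true, mul_one]
      exact_mod_cast this
    · intro k _ hk
      rw [if_neg, mul_zero]
      intro h
      apply hk
      rw [← (sumElim_injective h).1]
      rfl
    · intro h
      exact absurd (Finset.mem_piAntidiag.2 ⟨by rw [← hm, Finsupp.degree_eq_sum], by simp⟩) h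
  · rw [Finset.sum_eq_zero, mul_zero]
    intro k hk
    rw [if_neg, mul_zero]
    intro h'
    obtain ⟨h1, h2⟩ := sumElim_injective h'
    refine h ⟨h1.symm.trans h2, ?_⟩
    rw [← h1, Finsupp.degree_eq_sum]
    exact (Finset.mem_piAntidiag.1 hk).1

/-- The right side is written as a product over coordinates so that each factor is a one-variable
integral from `integral_complexHermite`. -/
theorem mixedCoeff_normSqPoly_pow_mul_monomial {m d : ℕ} {α β γ δ : Fin (n + 1) →₀ ℕ}
    (hα : α.degree = m + d) (hγ : γ.degree = d) :
    ((∏ i, ((α i).factorial : ℂ)) * ∏ i, ((β i).factorial : ℂ))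
        * mixedCoeff (normSqPoly n ^ m * MvPolynomial.monomial (Finsupp.sumElim γ δ) 1) α β
      = m.factorial * ∏ i, (if γ i + β i = δ i + α i
          then ((β i).factorial * (α i).descFactorial (γ i) : ℂ) else 0) := by
  have hcoeff : mixedCoeff (normSqPoly n ^ m * MvPolynomial.monomial (Finsupp.sumElim γ δ) 1) α β
      = if γ ≤ α ∧ δ ≤ β then mixedCoeff (normSqPoly n ^ m) (α - γ) (β - δ) else 0 := by
    unfold mixedCoeff
    rw [MvPolynomial.coeff_mul_monomial', mul_one]
    have h1 : Finsupp.sumElim γ δ ≤ Finsupp.sumElim α β ↔ γ ≤ α ∧ δ ≤ β := by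
      simp [Finsupp.le_def]
    have h2 : Finsupp.sumElim α β - Finsupp.sumElim γ δ = Finsupp.sumElim (α - γ) (β - δ) := by
      ext (i | i) <;> simp
    simp only [h1, h2]
  rw [hcoeff]
  by_cases hle : γ ≤ α ∧ δ ≤ β
  · rw [if_pos hle]
    have hfac : ∏ i, ((α i).factorial : ℂ)
        = (∏ i, ((α i).descFactorial (γ i) : ℂ)) * ∏ i, (((α - γ) i).factorial : ℂ) := by
      rw [← Finset.prod_mul_distrib]
      refine Finset.prod_congr rfl fun i _ => ?_
      rw [← Nat.factorial_mul_descFactorial (hle.1 i)]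
      push_cast
      simp [mul_comm]
    have hm := mixedCoeff_normSqPoly_pow m (α - γ) (β - δ)
    rw [hfac]
    by_cases heq : α - γ = β - δ
    · have hdeg : (α - γ).degree = m := by
        have : (α - γ + γ).degree = m + d := by rw [tsub_add_cancel_of_le hle.1, hα]
        rw [map_add, hγ] at this
        omega
      rw [if_pos ⟨heq, hdeg⟩] at hm
      have hcond : ∀ i, γ i + β i = δ i + α i := by
        intro i
        have h1 := DFunLike.congr_fun heq i
        have h2 := hle.1 i
        have h3 := hle.2 i
        simp only [Finsupp.coe_tsub, Pi.sub_apply] at h1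
        omega
      simp only [hcond, if_true, Finset.prod_mul_distrib]
      linear_combination ((∏ i, ((α i).descFactorial (γ i) : ℂ))
        * ∏ i, ((β i).factorial : ℂ)) * hm
    · rw [if_neg (fun h => heq h.1)] at hm
      obtain ⟨i, hi⟩ := DFunLike.ne_iff.1 heq
      rw [Finset.prod_eq_zero (f := fun i => if γ i + β i = δ i + α i then _ else _)
        (Finset.mem_univ i)]
      · linear_combination ((∏ i, ((α i).descFactorial (γ i) : ℂ))
          * ∏ i, ((β i).factorial : ℂ)) * hm
      · rw [if_neg]
        have h2 := hle.1 i
        have h3 := hle.2 i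
        simp only [Finsupp.coe_tsub, Pi.sub_apply] at hi
        omega
  · rw [if_neg hle, mul_zero]
    have : ∃ i, α i < γ i ∨ β i < δ i := by
      by_contra! h
      exact hle ⟨fun i => (h i).1, fun i => (h i).2⟩
    obtain ⟨i, hi⟩ := this
    rw [Finset.prod_eq_zero (Finset.mem_univ i), mul_zero]
    split_ifs with h
    -- Under the balance condition, `β i < δ i` forces `α i < γ i`, so the falling factorial
    -- vanishes in both cases.
    · rw [Nat.descFactorial_of_lt (by omega)]
      simp
    · rfl

theorem IsBihomogeneous.degree_eq {p : MixedPoly n} {d : ℕ} (hp : IsBihomogeneous p d)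
    {σ : Fin (n + 1) ⊕ Fin (n + 1) →₀ ℕ} (hσ : σ ∈ p.support) :
    ∃ γ δ : Fin (n + 1) →₀ ℕ, σ = Finsupp.sumElim γ δ ∧ γ.degree = d ∧ δ.degree = d := by
  obtain ⟨γ, δ, rfl⟩ := exists_eq_sumElim σ
  exact ⟨γ, δ, rfl, hp γ δ (MvPolynomial.mem_support_iff.1 hσ)⟩

theorem mixedCoeff_normSqPoly_pow_mul {p : MixedPoly n} {m : ℕ}
    (α β : Fin (n + 1) →₀ ℕ) :
    mixedCoeff (normSqPoly n ^ m * p) α β = ∑ σ ∈ p.support, MvPolynomial.coeff σ p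
      * mixedCoeff (normSqPoly n ^ m * MvPolynomial.monomial σ 1) α β := by
  unfold mixedCoeff
  conv_lhs => rw [p.as_sum, Finset.mul_sum, MvPolynomial.coeff_sum]
  refine Finset.sum_congr rfl fun σ _ => ?_
  rw [← MvPolynomial.coeff_C_mul]
  congr 1
  rw [mul_left_comm, MvPolynomial.C_mul_monomial, mul_one]

/-! ### Bihomogeneity and Hermitian symmetry of `|Z|^{2m} p` -/

theorem IsBihomogeneous.mul {p q : MixedPoly n} {d e : ℕ} (hp : IsBihomogeneous p d)
    (hq : IsBihomogeneous q e) : IsBihomogeneous (p * q) (d + e) := by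
  intro α β h
  unfold mixedCoeff at h
  rw [MvPolynomial.coeff_mul] at h
  obtain ⟨⟨σ, τ⟩, hστ, hne⟩ := Finset.exists_ne_zero_of_sum_ne_zero h
  obtain ⟨γ, δ, rfl⟩ := exists_eq_sumElim σ
  obtain ⟨γ', δ', rfl⟩ := exists_eq_sumElim τ
  have h1 := hp γ δ (left_ne_zero_of_mul hne)
  have h2 := hq γ' δ' (right_ne_zero_of_mul hne)
  have h3 : Finsupp.sumElim (γ + γ') (δ + δ') = Finsupp.sumElim α β := by
    rw [← Finset.HasAntidiagonal.mem_antidiagonal.1 hστ]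
    ext (i | i) <;> simp
  obtain ⟨rfl, rfl⟩ := sumElim_injective h3
  simp [h1, h2]

theorem isBihomogeneous_normSqPoly_pow (m : ℕ) : IsBihomogeneous (normSqPoly n ^ m) m := by
  intro α β h
  have h1 := mixedCoeff_normSqPoly_pow m α β
  have h2 : ∏ i, ((α i).factorial : ℂ) ≠ 0 :=
    Finset.prod_ne_zero_iff.2 fun i _ => by exact_mod_cast (α i).factorial_ne_zero
  by_cases hc : α = β ∧ α.degree = m
  · exact ⟨hc.2, hc.1 ▸ hc.2⟩
  · rw [if_neg hc] at h1
    exact absurd h1 (mul_ne_zero h2 h)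

/-- Conjugation of `ℂ[Z, Z̄]`, which exchanges `Z_i` and `Z̄_i`. -/
def conjPoly (n : ℕ) : MixedPoly n →+* MixedPoly n :=
  (MvPolynomial.rename Sum.swap).toRingHom.comp (MvPolynomial.map (starRingEnd ℂ))

theorem mixedCoeff_conjPoly (p : MixedPoly n) (α β : Fin (n + 1) →₀ ℕ) :
    mixedCoeff (conjPoly n p) α β = starRingEnd ℂ (mixedCoeff p β α) := by
  have h : Finsupp.sumElim α β
      = Finsupp.mapDomain Sum.swap (Finsupp.sumElim β α : Fin (n + 1) ⊕ Fin (n + 1) →₀ ℕ) := by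
    ext (i | i)
    · rw [← Sum.swap_inr, Finsupp.mapDomain_apply Sum.swap_leftInverse.injective]; simp
    · rw [← Sum.swap_inl, Finsupp.mapDomain_apply Sum.swap_leftInverse.injective]; simp
  simp only [mixedCoeff, conjPoly, RingHom.comp_apply, AlgHom.toRingHom_eq_coe, RingHom.coe_coe]
  rw [h, MvPolynomial.coeff_rename_mapDomain _ Sum.swap_leftInverse.injective,
    MvPolynomial.coeff_map]

theorem isHermitian_iff_conjPoly_eq {p : MixedPoly n} : IsHermitian p ↔ conjPoly n p = p := by
  constructor
  · intro h
    ext σ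
    obtain ⟨γ, δ, rfl⟩ := exists_eq_sumElim σ
    exact (mixedCoeff_conjPoly p γ δ).trans (h δ γ)
  · intro h α β
    rw [← mixedCoeff_conjPoly, h]

theorem isHermitian_normSqPoly_pow_mul {p : MixedPoly n} (hp : IsHermitian p) (m : ℕ) :
    IsHermitian (normSqPoly n ^ m * p) := by
  rw [isHermitian_iff_conjPoly_eq] at hp ⊢
  rw [map_mul, map_pow, hp]
  congr 2
  simp only [normSqPoly, map_sum]
  refine Finset.sum_congr rfl fun i _ => ?_
  simp [absSq, hol, antihol, conjPoly, mul_comm]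

/-! ### The Hermite symbol of a polynomial -/

/-- The function `exp (-h ∑ ∂_{z_i} ∂_{z̄_i}) p`. -/
def hermiteSymbol (p : MixedPoly n) (h : ℝ) (z : Fin (n + 1) → ℂ) : ℂ :=
  ∑ σ ∈ p.support, MvPolynomial.coeff σ p
    * ∏ i, complexHermite h (σ (Sum.inl i)) (σ (Sum.inr i)) (z i)

theorem hermiteSymbol_zero (p : MixedPoly n) (z : Fin (n + 1) → ℂ) :
    hermiteSymbol p 0 z = evalAt p z := by
  simp only [hermiteSymbol, evalAt, MvPolynomial.eval_eq', complexHermite_zero,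
    Fintype.prod_sum_type, Finset.prod_mul_distrib, Sum.elim_inl, Sum.elim_inr]

theorem continuous_hermiteSymbol (p : MixedPoly n) :
    Continuous fun x : ℝ × (Fin (n + 1) → ℂ) => hermiteSymbol p x.1 x.2 := by
  unfold hermiteSymbol
  refine continuous_finsetSum _ fun σ _ => continuous_const.mul
    (continuous_finsetProd _ fun i _ => ?_)
  exact (continuous_complexHermite _ _).comp
    (continuous_fst.prodMk ((continuous_apply i).comp continuous_snd))

theorem hermiteSymbol_smul {p : MixedPoly n} {d : ℕ} (hp : IsBihomogeneous p d) (h r : ℝ)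
    (z : Fin (n + 1) → ℂ) :
    hermiteSymbol p (r ^ 2 * h) (fun i => r * z i) = r ^ (2 * d) * hermiteSymbol p h z := by
  unfold hermiteSymbol
  rw [Finset.mul_sum]
  refine Finset.sum_congr rfl fun σ hσ => ?_
  obtain ⟨γ, δ, rfl, hγ, hδ⟩ := hp.degree_eq hσ
  simp only [complexHermite_smul, Finset.prod_mul_distrib, Finset.prod_pow_eq_pow_sum,
    Finset.sum_add_distrib]
  rw [Finsupp.degree_eq_sum] at hγ hδ
  simp only [Finsupp.coe_sumElim, Sum.elim_inl, Sum.elim_inr, hγ, hδ]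
  ring

theorem hermiteSymbol_of_degree_zero {p : MixedPoly n} (hp : IsBihomogeneous p 0) (h : ℝ)
    (z : Fin (n + 1) → ℂ) : hermiteSymbol p h z = hermiteSymbol p 0 0 := by
  unfold hermiteSymbol
  refine Finset.sum_congr rfl fun σ hσ => ?_
  obtain ⟨γ, δ, rfl, hγ, hδ⟩ := hp.degree_eq hσ
  rw [Finsupp.degree_eq_zero_iff] at hγ hδ
  simp [hγ, hδ, complexHermite]

attribute [irreducible] hermiteSymbol

/-! ### Lower bounds for the Hermite symbol -/

theorem isCompact_sum_norm_sq_le (T : ℝ) :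
    IsCompact {z : Fin (n + 1) → ℂ | ∑ i, ‖z i‖ ^ 2 ≤ T} := by
  refine Metric.isCompact_of_isClosed_isBounded (isClosed_le (by fun_prop) continuous_const) ?_
  refine (Metric.isBounded_closedBall (x := (0 : Fin (n + 1) → ℂ)) (r := Real.sqrt T)).subset ?_
  intro z hz
  rw [mem_closedBall_zero_iff, pi_norm_le_iff_of_nonneg (Real.sqrt_nonneg _)]
  intro i
  refine Real.le_sqrt_of_sq_le (le_trans ?_ hz)
  exact Finset.single_le_sum (f := fun i => ‖z i‖ ^ 2) (fun i _ => sq_nonneg _) (Finset.mem_univ i)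

/-- At `h = 0` the symbol is `p`, with a positive minimum on the compact sphere; the tube lemma
keeps half of it for small `h`. -/
theorem exists_pos_le_hermiteSymbol_sphere (p : MixedPoly n)
    (hpos : ∀ z : Fin (n + 1) → ℂ, z ≠ 0 → 0 < evalAt p z) :
    ∃ c > 0, ∃ ε > 0, ∀ h : ℝ, |h| < ε → ∀ u : Fin (n + 1) → ℂ, ∑ i, ‖u i‖ ^ 2 = 1 →
      c ≤ (hermiteSymbol p h u).re := by
  set S : Set (Fin (n + 1) → ℂ) := {u | ∑ i, ‖u i‖ ^ 2 = 1} with hS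
  have hScomp : IsCompact S := (isCompact_sum_norm_sq_le 1).of_isClosed_subset
    (isClosed_eq (by fun_prop) continuous_const) fun u hu => le_of_eq hu
  have hSne : S.Nonempty := ⟨Pi.single 0 1, by
    simp only [hS, Set.mem_ofPred_eq]
    rw [Finset.sum_eq_single 0] <;> simp +contextual⟩
  have hcont : Continuous fun x : ℝ × (Fin (n + 1) → ℂ) => (hermiteSymbol p x.1 x.2).re :=
    Complex.continuous_re.comp (continuous_hermiteSymbol p)
  obtain ⟨u₀, hu₀, hmin⟩ := hScomp.exists_isMinOn hSne
    (hcont.comp (Continuous.prodMk_right (0 : ℝ))).continuousOn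
  have hc : 0 < (hermiteSymbol p 0 u₀).re := by
    rw [hermiteSymbol_zero]
    refine (Complex.lt_def.1 (hpos u₀ ?_)).1
    rintro rfl
    simp [hS] at hu₀
  set c := (hermiteSymbol p 0 u₀).re
  obtain ⟨U, V, hU, -, h0U, hSV, hUV⟩ := generalized_tube_lemma (s := {(0 : ℝ)}) (t := S)
    isCompact_singleton hScomp (n := {x | c / 2 < (hermiteSymbol p x.1 x.2).re})
    (isOpen_lt continuous_const hcont) (by
      rintro ⟨h, u⟩ ⟨hh, hu⟩
      obtain rfl : h = 0 := hh
      have : c ≤ (hermiteSymbol p 0 u).re := hmin hu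
      simp only [Set.mem_ofPred_eq]
      linarith)
  obtain ⟨ε, hε, hball⟩ := Metric.isOpen_iff.1 hU 0 (h0U rfl)
  refine ⟨c / 2, by positivity, ε, hε, fun h hh u hu => le_of_lt ?_⟩
  exact hUV (Set.mk_mem_prod (hball (by simpa using hh)) (hSV hu))

/-- With `s = |z|²`, dilating by `√s` gives `σ_1(z) = s^d σ_{1/s}(z/√s)`, so large `z` reduces to
small `h` on the sphere. The remaining ball is compact and is absorbed in `K`. -/
theorem exists_le_hermiteSymbol {p : MixedPoly n} {d : ℕ} (hp : IsBihomogeneous p d)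
    (hd : 1 ≤ d) (hpos : ∀ z : Fin (n + 1) → ℂ, z ≠ 0 → 0 < evalAt p z) :
    ∃ c > 0, ∃ K : ℝ, ∀ z : Fin (n + 1) → ℂ,
      c * ∑ i, ‖z i‖ ^ 2 - K ≤ (hermiteSymbol p 1 z).re := by
  obtain ⟨c, hc, ε, hε, hsph⟩ := exists_pos_le_hermiteSymbol_sphere p hpos
  -- Beyond `T`, `s > 1` gives `s ≤ s^d`, and `s > 2/ε` gives `1/s < ε`.
  set T : ℝ := max 1 (2 / ε)
  have hcont : Continuous fun z : Fin (n + 1) → ℂ => (hermiteSymbol p 1 z).re :=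
    Complex.continuous_re.comp ((continuous_hermiteSymbol p).comp (Continuous.prodMk_right (1 : ℝ)))
  obtain ⟨B, hB⟩ := (isCompact_sum_norm_sq_le (n := n) T).bddBelow_image hcont.continuousOn
  refine ⟨c, hc, |B| + c * T, fun z => ?_⟩
  have hT : 0 < T := lt_of_lt_of_le one_pos (le_max_left _ _)
  rcases le_or_gt (∑ i, ‖z i‖ ^ 2) T with hz | hz
  · have h1 : B ≤ (hermiteSymbol p 1 z).re := hB ⟨z, hz, rfl⟩
    have h2 := mul_le_mul_of_nonneg_left hz hc.le
    linarith [neg_abs_le B]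
  · set s : ℝ := ∑ i, ‖z i‖ ^ 2
    have hs1 : 1 < s := lt_of_le_of_lt (le_max_left _ _) hz
    have hs0 : 0 < s := one_pos.trans hs1
    have hsε : 2 / ε < s := lt_of_le_of_lt (le_max_right _ _) hz
    set r : ℝ := Real.sqrt s
    have hr : r ^ 2 = s := Real.sq_sqrt hs0.le
    have hr0 : 0 < r := Real.sqrt_pos.2 hs0
    have hrc : (r : ℂ) ≠ 0 := by exact_mod_cast hr0.ne'
    have hscale := hermiteSymbol_smul hp s⁻¹ r (fun i => (r : ℂ)⁻¹ * z i)
    rw [hr, mul_inv_cancel₀ hs0.ne'] at hscale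
    simp only [mul_inv_cancel_left₀ hrc] at hscale
    have hbound := hsph s⁻¹ (by
      rw [abs_of_pos (inv_pos.2 hs0), inv_lt_comm₀ hs0 hε]
      refine lt_of_le_of_lt ?_ hsε
      rw [inv_eq_one_div]
      gcongr
      norm_num) (fun i => (r : ℂ)⁻¹ * z i) (by
      simp only [norm_mul, mul_pow, norm_inv, Complex.norm_real, Real.norm_of_nonneg hr0.le,
        inv_pow, hr, ← Finset.mul_sum]
      exact inv_mul_cancel₀ hs0.ne')
    have hre : (hermiteSymbol p 1 z).re
        = s ^ d * (hermiteSymbol p s⁻¹ fun i => (r : ℂ)⁻¹ * z i).re := by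
      rw [show hermiteSymbol p 1 z = _ from hscale, ← hr, ← pow_mul, ← Complex.ofReal_pow,
        Complex.re_ofReal_mul]
    rw [hre]
    have hsd : s ≤ s ^ d := le_self_pow₀ hs1.le (by omega)
    have h1 : s * c ≤ s ^ d * (hermiteSymbol p s⁻¹ fun i => (r : ℂ)⁻¹ * z i).re :=
      mul_le_mul hsd hbound hc.le (by positivity)
    have h2 : 0 < c * T := mul_pos hc hT
    linarith [abs_nonneg B]

/-! ### Gaussian integrals over `ℂ^{n+1}` -/

/-- The Gaussian probability measure on `ℂ^{n+1}`. -/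
def gaussianPi (n : ℕ) : Measure (Fin (n + 1) → ℂ) := Measure.pi fun _ => gaussianMeasure

/-- The monomial function `z^α`. -/
def monomialFun (α : Fin (n + 1) → ℕ) (z : Fin (n + 1) → ℂ) : ℂ := ∏ i, z i ^ α i

theorem integrable_monomialFun (β α : Fin (n + 1) → ℕ) :
    Integrable (fun z => monomialFun β z * starRingEnd ℂ (monomialFun α z)) (gaussianPi n) := by
  simp only [monomialFun, map_prod, map_pow, ← Finset.prod_mul_distrib]
  exact Integrable.fintype_prod (f := fun i w => w ^ β i * starRingEnd ℂ w ^ α i)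
    fun i => integrable_gaussian_monomial _ _

theorem integral_monomialFun (β α : Fin (n + 1) → ℕ) :
    ∫ z, monomialFun β z * starRingEnd ℂ (monomialFun α z) ∂gaussianPi n
      = if β = α then ∏ i, ((α i).factorial : ℂ) else 0 := by
  simp only [monomialFun, map_prod, map_pow, ← Finset.prod_mul_distrib, gaussianPi]
  rw [integral_fintype_prod_eq_prod (fun i w => w ^ β i * starRingEnd ℂ w ^ α i)]
  simp only [integral_gaussian_monomial]
  split_ifs with h
  · simp [h]
  · obtain ⟨i, hi⟩ := Function.ne_iff.1 h
    exact Finset.prod_eq_zero (Finset.mem_univ i) (if_neg hi)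

theorem hermiteSymbol_mul_monomialFun (p : MixedPoly n) (β α : Fin (n + 1) → ℕ)
    (z : Fin (n + 1) → ℂ) :
    hermiteSymbol p 1 z * (monomialFun β z * starRingEnd ℂ (monomialFun α z))
      = ∑ σ ∈ p.support, MvPolynomial.coeff σ p
        * ∏ i, (complexHermite 1 (σ (Sum.inl i)) (σ (Sum.inr i)) (z i)
          * (z i ^ β i * starRingEnd ℂ (z i) ^ α i)) := by
  unfold hermiteSymbol
  simp only [monomialFun, map_prod, map_pow, Finset.prod_mul_distrib, Finset.sum_mul, mul_assoc]

theorem integrable_prod_complexHermite (σ : Fin (n + 1) ⊕ Fin (n + 1) → ℕ)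
    (β α : Fin (n + 1) → ℕ) :
    Integrable (fun z => ∏ i, (complexHermite 1 (σ (Sum.inl i)) (σ (Sum.inr i)) (z i)
      * (z i ^ β i * starRingEnd ℂ (z i) ^ α i))) (gaussianPi n) :=
  Integrable.fintype_prod (f := fun i w => complexHermite 1 (σ (Sum.inl i)) (σ (Sum.inr i)) w
    * (w ^ β i * starRingEnd ℂ w ^ α i)) fun _ => integrable_complexHermite _ _ _ _ _

theorem integrable_hermiteSymbol_mul (p : MixedPoly n) (β α : Fin (n + 1) → ℕ) :
    Integrable (fun z => hermiteSymbol p 1 z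
      * (monomialFun β z * starRingEnd ℂ (monomialFun α z))) (gaussianPi n) := by
  simp only [hermiteSymbol_mul_monomialFun]
  exact integrable_finsetSum _ fun σ _ => (integrable_prod_complexHermite σ β α).const_mul _

/-- Both sides are linear in `p`; for a monomial the integral splits over coordinates by Fubini. -/
theorem factorial_mul_mixedCoeff_eq_integral {p : MixedPoly n} {m d : ℕ}
    (hp : IsBihomogeneous p d) {α : Fin (n + 1) →₀ ℕ} (hα : α.degree = m + d)
    (β : Fin (n + 1) →₀ ℕ) :
    ((∏ i, ((α i).factorial : ℂ)) * ∏ i, ((β i).factorial : ℂ))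
        * mixedCoeff (normSqPoly n ^ m * p) α β
      = m.factorial * ∫ z, hermiteSymbol p 1 z
          * (monomialFun β z * starRingEnd ℂ (monomialFun α z)) ∂gaussianPi n := by
  simp only [hermiteSymbol_mul_monomialFun]
  rw [integral_finsetSum _ fun (σ : Fin (n + 1) ⊕ Fin (n + 1) →₀ ℕ) _ =>
      (integrable_prod_complexHermite σ β α).const_mul _,
    mixedCoeff_normSqPoly_pow_mul, Finset.mul_sum, Finset.mul_sum]
  refine Finset.sum_congr rfl fun σ hσ => ?_
  obtain ⟨γ, δ, rfl, hγ, -⟩ := hp.degree_eq hσ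
  rw [integral_const_mul, gaussianPi, integral_fintype_prod_eq_prod (fun i w =>
    complexHermite 1 (Finsupp.sumElim γ δ (Sum.inl i)) (Finsupp.sumElim γ δ (Sum.inr i)) w
      * (w ^ β i * starRingEnd ℂ w ^ α i))]
  simp only [integral_complexHermite, Finsupp.coe_sumElim, Sum.elim_inl, Sum.elim_inr]
  rw [mul_left_comm, mixedCoeff_normSqPoly_pow_mul_monomial hα hγ, mul_left_comm]

/-! ### Quadratic forms of polynomial functions -/

/-- The polynomial function `∑ y_α z^{e α}`. -/
def polyFun {ι : Type*} [Fintype ι] (e : ι → Fin (n + 1) → ℕ) (y : ι → ℂ)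
    (z : Fin (n + 1) → ℂ) : ℂ := ∑ α, y α * monomialFun (e α) z

section

variable {ι : Type*} [Fintype ι] (e : ι → Fin (n + 1) → ℕ) (y : ι → ℂ)

theorem polyFun_norm_sq (z : Fin (n + 1) → ℂ) :
    ((‖polyFun e y z‖ ^ 2 : ℝ) : ℂ) = ∑ β, ∑ α, (y β * starRingEnd ℂ (y α))
      * (monomialFun (e β) z * starRingEnd ℂ (monomialFun (e α) z)) := by
  rw [← Complex.normSq_eq_norm_sq, ← Complex.mul_conj, polyFun, map_sum, Finset.sum_mul_sum]
  refine Finset.sum_congr rfl fun β _ => Finset.sum_congr rfl fun α _ => ?_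
  rw [map_mul]; ring

theorem integrable_polyFun_norm_sq :
    Integrable (fun z => ‖polyFun e y z‖ ^ 2) (gaussianPi n) := by
  have h : Integrable (fun z => ((‖polyFun e y z‖ ^ 2 : ℝ) : ℂ)) (gaussianPi n) := by
    simp only [polyFun_norm_sq]
    exact integrable_finsetSum _ fun β _ => integrable_finsetSum _ fun α _ =>
      (integrable_monomialFun _ _).const_mul _
  simpa only [Complex.ofReal_re, RCLike.re_to_complex] using h.re

theorem integral_polyFun_norm_sq (he : Function.Injective e) :
    ∫ z, ‖polyFun e y z‖ ^ 2 ∂gaussianPi n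
      = ∑ α, ‖y α‖ ^ 2 * ∏ i, ((e α i).factorial : ℝ) := by
  classical
  apply Complex.ofReal_injective
  rw [← integral_complex_ofReal]
  simp only [polyFun_norm_sq]
  rw [integral_finsetSum _ fun β _ => integrable_finsetSum _ fun α _ =>
      (integrable_monomialFun _ _).const_mul _, Complex.ofReal_sum]
  refine Finset.sum_congr rfl fun β _ => ?_
  rw [integral_finsetSum _ fun α _ => (integrable_monomialFun _ _).const_mul _]
  simp only [integral_const_mul, integral_monomialFun, he.eq_iff, mul_ite, mul_zero]
  rw [Finset.sum_ite_eq, if_pos (Finset.mem_univ _), Complex.mul_conj, Complex.normSq_eq_norm_sq]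
  push_cast
  rfl

theorem norm_mul_polyFun (j : Fin (n + 1)) (z : Fin (n + 1) → ℂ) :
    ‖z j‖ ^ 2 * ‖polyFun e y z‖ ^ 2 = ‖polyFun (fun α => e α + Pi.single j 1) y z‖ ^ 2 := by
  rw [← mul_pow, ← norm_mul]
  congr 2
  unfold polyFun
  rw [Finset.mul_sum]
  refine Finset.sum_congr rfl fun α _ => ?_
  simp only [monomialFun, Pi.add_apply, pow_add, Finset.prod_mul_distrib]
  have : ∏ i, z i ^ (Pi.single j 1 : Fin (n + 1) → ℕ) i = z j := by
    rw [Finset.prod_eq_single j] <;> simp +contextual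
  rw [this]
  ring

theorem sum_norm_mul_polyFun (z : Fin (n + 1) → ℂ) :
    (∑ j, ‖z j‖ ^ 2) * ‖polyFun e y z‖ ^ 2
      = ∑ j, ‖polyFun (fun α => e α + Pi.single j 1) y z‖ ^ 2 := by
  rw [Finset.sum_mul]
  exact Finset.sum_congr rfl fun j _ => norm_mul_polyFun e y j z

theorem integrable_sum_norm_mul_polyFun :
    Integrable (fun z => (∑ j, ‖z j‖ ^ 2) * ‖polyFun e y z‖ ^ 2) (gaussianPi n) := by
  simp only [sum_norm_mul_polyFun]
  exact integrable_finsetSum _ fun j _ => integrable_polyFun_norm_sq _ _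

/-- Multiplication by `z_j` sends `z^α` to a monomial whose squared norm is `α_j + 1` times larger
and keeps distinct monomials orthogonal; summing over the `n + 1` coordinates gives `N + n + 1`. -/
theorem integral_sum_norm_mul_polyFun (he : Function.Injective e) {N : ℕ}
    (hN : ∀ α, ∑ i, e α i = N) :
    ∫ z, (∑ j, ‖z j‖ ^ 2) * ‖polyFun e y z‖ ^ 2 ∂gaussianPi n
      = (N + n + 1) * ∫ z, ‖polyFun e y z‖ ^ 2 ∂gaussianPi n := by
  simp only [sum_norm_mul_polyFun]
  rw [integral_finsetSum _ fun j _ => integrable_polyFun_norm_sq _ _,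
    integral_polyFun_norm_sq e y he]
  have : ∀ j : Fin (n + 1), Function.Injective fun α => e α + Pi.single j 1 :=
    fun j => (add_left_injective _).comp he
  simp only [integral_polyFun_norm_sq _ y (this _)]
  rw [Finset.sum_comm, Finset.mul_sum]
  refine Finset.sum_congr rfl fun α _ => ?_
  have hfac : ∀ j, ∏ i, (((e α + Pi.single j 1 : Fin (n + 1) → ℕ) i).factorial : ℝ)
      = (e α j + 1) * ∏ i, ((e α i).factorial : ℝ) := by
    intro j
    rw [← Finset.mul_prod_erase _ _ (Finset.mem_univ j),
      ← Finset.mul_prod_erase _ (fun i => ((e α i).factorial : ℝ)) (Finset.mem_univ j), ← mul_assoc]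
    congr 1
    · simp [Nat.factorial_succ]
    · refine Finset.prod_congr rfl fun i hi => ?_
      simp [Finset.ne_of_mem_erase hi]
  simp only [hfac]
  rw [← Finset.mul_sum, ← Finset.sum_mul, Finset.sum_add_distrib, ← Nat.cast_sum, hN]
  simp
  ring

theorem hermiteSymbol_mul_polyFun (p : MixedPoly n) (z : Fin (n + 1) → ℂ) :
    hermiteSymbol p 1 z * ((‖polyFun e y z‖ ^ 2 : ℝ) : ℂ)
      = ∑ β, ∑ α, (y β * starRingEnd ℂ (y α)) * (hermiteSymbol p 1 z
          * (monomialFun (e β) z * starRingEnd ℂ (monomialFun (e α) z))) := by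
  rw [polyFun_norm_sq]
  simp only [Finset.mul_sum]
  refine Finset.sum_congr rfl fun β _ => Finset.sum_congr rfl fun α _ => ?_
  rw [mul_left_comm]

theorem integrable_hermiteSymbol_mul_polyFun (p : MixedPoly n) :
    Integrable (fun z => hermiteSymbol p 1 z * ((‖polyFun e y z‖ ^ 2 : ℝ) : ℂ))
      (gaussianPi n) := by
  simp only [hermiteSymbol_mul_polyFun]
  exact integrable_finsetSum _ fun β _ => integrable_finsetSum _ fun α _ =>
    (integrable_hermiteSymbol_mul _ _ _).const_mul _

theorem integral_hermiteSymbol_mul_polyFun (p : MixedPoly n) :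
    ∫ z, hermiteSymbol p 1 z * ((‖polyFun e y z‖ ^ 2 : ℝ) : ℂ) ∂gaussianPi n
      = ∑ β, ∑ α, (y β * starRingEnd ℂ (y α)) * ∫ z, hermiteSymbol p 1 z
          * (monomialFun (e β) z * starRingEnd ℂ (monomialFun (e α) z)) ∂gaussianPi n := by
  simp only [hermiteSymbol_mul_polyFun]
  rw [integral_finsetSum _ fun β _ => integrable_finsetSum _ fun α _ =>
    (integrable_hermiteSymbol_mul _ _ _).const_mul _]
  refine Finset.sum_congr rfl fun β _ => ?_
  rw [integral_finsetSum _ fun α _ => (integrable_hermiteSymbol_mul _ _ _).const_mul _]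
  simp only [integral_const_mul]

theorem integral_hermiteSymbol_mul_polyFun_pos (he : Function.Injective e) {N : ℕ}
    (hN : ∀ α, ∑ i, e α i = N) {y : ι → ℂ} (hy : y ≠ 0) {p : MixedPoly n} {c K : ℝ}
    (hK : K < c * (N + n + 1))
    (hbound : ∀ z, c * ∑ i, ‖z i‖ ^ 2 - K ≤ (hermiteSymbol p 1 z).re) :
    0 < (∫ z, hermiteSymbol p 1 z * ((‖polyFun e y z‖ ^ 2 : ℝ) : ℂ) ∂gaussianPi n).re := by
  have hI : 0 < ∫ z, ‖polyFun e y z‖ ^ 2 ∂gaussianPi n := by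
    rw [integral_polyFun_norm_sq e y he]
    obtain ⟨α, hα⟩ := Function.ne_iff.1 hy
    refine Finset.sum_pos' (fun α _ => by positivity) ⟨α, Finset.mem_univ _, ?_⟩
    have : 0 < ‖y α‖ := norm_pos_iff.2 hα
    positivity
  have hint := integrable_hermiteSymbol_mul_polyFun e y p
  calc 0 < (c * (N + n + 1) - K) * ∫ z, ‖polyFun e y z‖ ^ 2 ∂gaussianPi n :=
        mul_pos (sub_pos.2 hK) hI
    _ = ∫ z, (c * ((∑ j, ‖z j‖ ^ 2) * ‖polyFun e y z‖ ^ 2) - K * ‖polyFun e y z‖ ^ 2)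
          ∂gaussianPi n := by
        rw [integral_sub ((integrable_sum_norm_mul_polyFun e y).const_mul c)
          ((integrable_polyFun_norm_sq e y).const_mul K), integral_const_mul, integral_const_mul,
          integral_sum_norm_mul_polyFun e y he hN]
        ring
    _ ≤ ∫ z, (hermiteSymbol p 1 z * ((‖polyFun e y z‖ ^ 2 : ℝ) : ℂ)).re ∂gaussianPi n := by
        refine integral_mono (((integrable_sum_norm_mul_polyFun e y).const_mul c).sub
          ((integrable_polyFun_norm_sq e y).const_mul K)) hint.re fun z => ?_
        simp only [Complex.re_mul_ofReal]
        have := mul_le_mul_of_nonneg_right (hbound z) (sq_nonneg ‖polyFun e y z‖)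
        linarith
    _ = _ := integral_re hint

end

/-! ### Positive definiteness of the coefficient matrix -/

theorem exists_hermiteSymbol_bound {p : MixedPoly n} {d : ℕ} (hp : IsBihomogeneous p d)
    (hpos : ∀ z : Fin (n + 1) → ℂ, z ≠ 0 → 0 < evalAt p z) :
    ∃ (c K : ℝ) (M : ℕ), (∀ N : ℕ, M ≤ N → K < c * (N + n + 1)) ∧
      ∀ z : Fin (n + 1) → ℂ, c * ∑ i, ‖z i‖ ^ 2 - K ≤ (hermiteSymbol p 1 z).re := by
  rcases Nat.eq_zero_or_pos d with rfl | hd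
  · have h1 : 0 < (hermiteSymbol p 0 0).re := by
      rw [← hermiteSymbol_of_degree_zero hp 0 1, hermiteSymbol_zero]
      exact (Complex.lt_def.1 (hpos 1 one_ne_zero)).1
    -- For `d = 0` the symbol is a positive constant, so no quadratic growth is needed and every
    -- degree works.
    refine ⟨0, -(hermiteSymbol p 0 0).re, 0, fun N _ => by simpa using h1, fun z => ?_⟩
    rw [hermiteSymbol_of_degree_zero hp 1 z]
    simp
  · obtain ⟨c, hc, K, hK⟩ := exists_le_hermiteSymbol hp hd hpos
    obtain ⟨M, hM⟩ := exists_nat_gt (K / c)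
    refine ⟨c, K, M, fun N hN => ?_, hK⟩
    rw [div_lt_iff₀ hc] at hM
    have h1 : (M : ℝ) ≤ N := by exact_mod_cast hN
    nlinarith [(Nat.cast_nonneg n : (0 : ℝ) ≤ n)]

/-- The matrix of coefficients of `Z^α Z̄^β` in a polynomial, with `|α| = |β| = N`. -/
def coeffMatrix (q : MixedPoly n) (N : ℕ) : Matrix (MultiIndex n N) (MultiIndex n N) ℂ :=
  Matrix.of fun α β => mixedCoeff q α.1 β.1

theorem IsHermitian.coeffMatrix {q : MixedPoly n} (hq : IsHermitian q) (N : ℕ) :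
    (coeffMatrix q N).IsHermitian :=
  Matrix.IsHermitian.ext fun α β => hq β.1 α.1

/-- Dividing `x α` by `α!` absorbs the factor `α! β!` of the integral formula. -/
theorem dotProduct_coeffMatrix_mulVec {p : MixedPoly n} {m d : ℕ} (hp : IsBihomogeneous p d)
    (x : MultiIndex n (m + d) → ℂ) :
    star x ⬝ᵥ (coeffMatrix (normSqPoly n ^ m * p) (m + d)).mulVec x
      = m.factorial * ∫ z, hermiteSymbol p 1 z * ((‖polyFun
          (fun α : MultiIndex n (m + d) => (α.1 : Fin (n + 1) → ℕ))
          (fun α => x α / ∏ i, ((α.1 i).factorial : ℂ)) z‖ ^ 2 : ℝ) : ℂ) ∂gaussianPi n := by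
  rw [integral_hermiteSymbol_mul_polyFun, Finset.sum_comm]
  simp only [dotProduct, Matrix.mulVec, Finset.mul_sum]
  refine Finset.sum_congr rfl fun α _ => Finset.sum_congr rfl fun β _ => ?_
  have h := factorial_mul_mixedCoeff_eq_integral (m := m) hp α.2 β.1
  have hne : ∀ γ : Fin (n + 1) →₀ ℕ, ∏ i, ((γ i).factorial : ℂ) ≠ 0 := fun γ =>
    Finset.prod_ne_zero_iff.2 fun i _ => by exact_mod_cast (γ i).factorial_ne_zero
  have hα := hne α.1
  have hβ := hne β.1
  rw [mul_left_comm (m.factorial : ℂ), ← h]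
  simp only [coeffMatrix, Matrix.of_apply, Pi.star_apply, map_div₀, map_prod, map_natCast,
    RCLike.star_def]
  field_simp

theorem exists_posDef_coeffMatrix {p : MixedPoly n} {d : ℕ} (hp : IsBihomogeneous p d)
    (hherm : IsHermitian p) (hpos : ∀ z : Fin (n + 1) → ℂ, z ≠ 0 → 0 < evalAt p z) :
    ∃ M : ℕ, ∀ m : ℕ, M ≤ m → (coeffMatrix (normSqPoly n ^ m * p) (m + d)).PosDef := by
  obtain ⟨c, K, M, hM, hbound⟩ := exists_hermiteSymbol_bound hp hpos
  refine ⟨M, fun m hm => ?_⟩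
  have hA := (isHermitian_normSqPoly_pow_mul hherm m).coeffMatrix (m + d)
  refine Matrix.PosDef.of_dotProduct_mulVec_pos hA fun x hx => ?_
  -- A Hermitian form takes real values, so only the real part has to be estimated.
  have him : (star x ⬝ᵥ (coeffMatrix (normSqPoly n ^ m * p) (m + d)).mulVec x).im = 0 :=
    hA.im_star_dotProduct_mulVec_self x
  rw [Complex.lt_def]
  refine ⟨?_, him.symm⟩
  rw [dotProduct_coeffMatrix_mulVec hp, ← Complex.ofReal_natCast, Complex.re_ofReal_mul]
  refine mul_pos (by exact_mod_cast m.factorial_pos)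
    (integral_hermiteSymbol_mul_polyFun_pos _ (DFunLike.coe_injective.comp Subtype.val_injective)
      (N := m + d) (fun α => ?_) ?_ (hM _ (hm.trans (Nat.le_add_right m d))) hbound)
  · exact (Finsupp.degree_eq_sum α.1).symm.trans α.2
  · obtain ⟨α, hα⟩ := Function.ne_iff.1 hx
    refine Function.ne_iff.2 ⟨α, div_ne_zero hα ?_⟩
    exact Finset.prod_ne_zero_iff.2 fun i _ => by exact_mod_cast (α.1 i).factorial_ne_zero

/-! ### Bases of homogeneous polynomials -/

/-- The coefficients of a homogeneous polynomial, as a linear equivalence. -/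
def homogeneousCoeffEquiv (n N : ℕ) :
    MvPolynomial.homogeneousSubmodule (Fin (n + 1)) ℂ N ≃ₗ[ℂ] (MultiIndex n N → ℂ) where
  toFun s α := MvPolynomial.coeff α.1 (s : HolPoly n)
  map_add' s t := by ext; simp
  map_smul' a s := by ext; simp
  invFun y := ⟨∑ α, MvPolynomial.monomial α.1 (y α), Submodule.sum_mem _ fun α _ =>
    MvPolynomial.isHomogeneous_monomial _ α.2⟩
  left_inv s := by
    classical
    ext β
    simp only [MvPolynomial.coeff_sum, MvPolynomial.coeff_monomial]
    by_cases hβ : β.degree = N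
    · rw [Finset.sum_eq_single ⟨β, hβ⟩]
      · simp
      · intro α _ hα
        exact if_neg fun h => hα (Subtype.ext h)
      · simp
    · rw [Finset.sum_eq_zero fun (α : MultiIndex n N) _ => if_neg fun h : α.1 = β => hβ (h ▸ α.2)]
      have hs : (s : HolPoly n).IsHomogeneous N := s.2
      exact (hs.coeff_eq_zero hβ).symm
  right_inv y := by
    classical
    ext β
    simp only [MvPolynomial.coeff_sum, MvPolynomial.coeff_monomial, ← Subtype.ext_iff]
    simp

theorem homogeneousCoeffEquiv_apply {N : ℕ}
    (s : MvPolynomial.homogeneousSubmodule (Fin (n + 1)) ℂ N) (α : MultiIndex n N) :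
    homogeneousCoeffEquiv n N s α = MvPolynomial.coeff α.1 (s : HolPoly n) := rfl

/-! ### From a positive definite matrix to a sum of squares -/

theorem mixedCoeff_hol_mul_antihol (s t : HolPoly n) (α β : Fin (n + 1) →₀ ℕ) :
    mixedCoeff (hol s * antihol t) α β
      = MvPolynomial.coeff α s * starRingEnd ℂ (MvPolynomial.coeff β t) := by
  classical
  unfold mixedCoeff hol antihol
  induction s using MvPolynomial.induction_on' with
  | add s s' hs hs' => simp only [map_add, add_mul, MvPolynomial.coeff_add, hs, hs']
  | monomial u a =>
    induction t using MvPolynomial.induction_on' with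
    | add t t' ht ht' => simp only [map_add, mul_add, MvPolynomial.coeff_add, ht, ht']
    | monomial v b =>
      have h : Finsupp.mapDomain Sum.inl u + Finsupp.mapDomain Sum.inr v
          = Finsupp.sumElim u v := by
        ext (i | i)
        · rw [Finsupp.add_apply, Finsupp.mapDomain_apply Sum.inl_injective,
            Finsupp.mapDomain_of_notMem_range _ _ (by simp)]
          simp
        · rw [Finsupp.add_apply, Finsupp.mapDomain_apply Sum.inr_injective,
            Finsupp.mapDomain_of_notMem_range _ _ (by simp)]
          simp
      have h' : Finsupp.sumElim u v = Finsupp.sumElim α β ↔ u = α ∧ v = β :=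
        ⟨sumElim_injective, fun h => by rw [h.1, h.2]⟩
      rw [MvPolynomial.map_monomial, MvPolynomial.rename_monomial, MvPolynomial.rename_monomial,
        MvPolynomial.monomial_mul, h]
      simp only [MvPolynomial.coeff_monomial, h']
      by_cases h1 : u = α <;> by_cases h2 : v = β <;> simp [h1, h2]

open scoped MatrixOrder in
-- Write the matrix as `B* B`. The conjugated rows of `B` are the coefficient vectors of the `s η`;
-- invertibility of `B` makes them a basis.
theorem exists_basis_sum_absSq {q : MixedPoly n} {N : ℕ} (hq : IsBihomogeneous q N)
    (hA : (coeffMatrix q N).PosDef) :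
    ∃ s : Module.Basis (MultiIndex n N) ℂ
        (MvPolynomial.homogeneousSubmodule (Fin (n + 1)) ℂ N),
      q = ∑ η, absSq (s η : HolPoly n) := by
  classical
  obtain ⟨B, hB, hAB⟩ := CStarAlgebra.isStrictlyPositive_iff_eq_star_mul_self.mp
    hA.isStrictlyPositive
  have hBu : IsUnit B.conjTranspose := hB.star
  let E := Matrix.toLinearEquiv' B.conjTranspose hBu.invertible
  let s := Module.Basis.ofEquivFun ((homogeneousCoeffEquiv n N).trans E.symm)
  have hs : ∀ η α, MvPolynomial.coeff α.1 (s η : HolPoly n) = star (B η α) := by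
    intro η α
    have h1 : (homogeneousCoeffEquiv n N) (s η) = B.conjTranspose.mulVec (Pi.single η 1) := by
      simp only [s, Module.Basis.coe_ofEquivFun, LinearEquiv.trans_symm, LinearEquiv.trans_apply,
        LinearEquiv.apply_symm_apply, LinearEquiv.symm_symm]
      rfl
    rw [← homogeneousCoeffEquiv_apply, h1]
    simp
  refine ⟨s, ?_⟩
  ext σ
  obtain ⟨α, β, rfl⟩ := exists_eq_sumElim σ
  rw [MvPolynomial.coeff_sum]
  change mixedCoeff q α β = ∑ η, mixedCoeff (absSq (s η : HolPoly n)) α β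
  simp only [absSq, mixedCoeff_hol_mul_antihol]
  by_cases h : α.degree = N ∧ β.degree = N
  · have h1 : mixedCoeff q α β = coeffMatrix q N ⟨α, h.1⟩ ⟨β, h.2⟩ := rfl
    rw [h1, hAB, Matrix.mul_apply]
    refine Finset.sum_congr rfl fun η _ => ?_
    rw [hs η ⟨α, h.1⟩, hs η ⟨β, h.2⟩]
    simp
  · have h1 : mixedCoeff q α β = 0 := by
      by_contra hne
      exact h (hq α β hne)
    rw [h1]
    refine (Finset.sum_eq_zero fun η _ => ?_).symm
    have hhom : (s η : HolPoly n).IsHomogeneous N := (s η).2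
    rcases not_and_or.1 h with hα | hβ
    · rw [hhom.coeff_eq_zero hα, zero_mul]
    · rw [hhom.coeff_eq_zero hβ, map_zero, mul_zero]

end HermitianPoly

end

theorem mainTheorem2 (n : ℕ) (hn : 0 < n) (d : ℕ) (p : HermitianPoly.MixedPoly n)
    (hbihom : HermitianPoly.IsBihomogeneous p d)
    (hherm : HermitianPoly.IsHermitian p)
    (hpos : ∀ z : Fin (n + 1) → ℂ, z ≠ 0 → 0 < HermitianPoly.evalAt p z) :
    ∃ M : ℕ, ∀ m : ℕ, M ≤ m →
      ∃ s : Module.Basis (HermitianPoly.MultiIndex n (m + d)) ℂ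
          (MvPolynomial.homogeneousSubmodule (Fin (n + 1)) ℂ (m + d)),
        (∑ i : Fin (n + 1), HermitianPoly.absSq (MvPolynomial.X i : HermitianPoly.HolPoly n)) ^ m * p
          = ∑ η : HermitianPoly.MultiIndex n (m + d),
              HermitianPoly.absSq (s η : HermitianPoly.HolPoly n) := by
  obtain ⟨M, hM⟩ := HermitianPoly.exists_posDef_coeffMatrix hbihom hherm hpos
  exact ⟨M, fun m hm => HermitianPoly.exists_basis_sum_absSq
    ((HermitianPoly.isBihomogeneous_normSqPoly_pow m).mul hbihom) (hM m hm)⟩
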